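/- Let $K$ be a complete valued field extension of $\mathbb{Q}_p$ (for instance a finite extension of $\mathbb{Q}_p$), let $q\in K^\times$ with $|q|<1$, and let $E_q=K^\times/q^{\mathbb Z}$ be the Tate curve. A holomorphic function on $K^\times$ is a function given by a Laurent series $\sum_{n\in\mathbb Z}a_nu^n$ with $a_n\in K$ that converges for all $u\in K^\times$; meromorphic functions are elements of the quotient field of the ring of holomorphic functions. A (meromorphic) theta function with respect to $q^{\mathbb Z}$ is a meromorphic function $f$ with $f(u)=c\,u^r f(qu)$ for some $c\in K^\times$, $r\in\mathbb Z$. Let $l\ge 3$ be a prime. Then one can choose, for every $Q\in K^\times$ whose class in $E_q$ is a nontrivial $l$-torsion point (that is, $Q^l\in q^{\mathbb Z}$ and $Q\notin q^{\mathbb Z}$), a meromorphic function $f_Q$ on $K^\times$ with the following properties. 1. $f_Q$ is a theta function with respect to $q^{\mathbb Z}$. 2. The divisor of $f_Q$ on $E_q$ is $(1)/(Q)$ (additively, $(1)-(Q)$): $f_Q$ has simple zeros exactly at the points of $q^{\mathbb Z}$, simple poles exactly at the points of $Qq^{\mathbb Z}$, and no other zeros or poles, not even at points of algebraic extensions of $K$.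 3. $f_Q(u)\sim 1-u$ as $u\to 1$, that is, $f_Q(u)/(1-u)\to 1$; and for every $m\in\mathbb Z$ and $Q'=Qq^m$ there is an $l$-th root of unity $\mu$ such that $f_{Q'}=\mu f_Q$. -/

import Mathlib

open Filter Topology Polynomial

namespace TateTheta

variable (K : Type*) [NormedField K] [IsUltrametricDist K] [CompleteSpace K]

/-- The ring of holomorphic functions on `Kˣ`: the functions `Kˣ → K` given by a two-sided Laurent
series `∑ aₙ uⁿ` with coefficients in `K` that converges at every `u ∈ Kˣ`. -/
def Holo : Subalgebra K (Kˣ → K) where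
  carrier := {f | ∃ a : ℤ → K, ∀ u : Kˣ, HasSum (fun n : ℤ => a n * (u : K) ^ n) (f u)}
  add_mem' := by
    rintro f g ⟨a, ha⟩ ⟨b, hb⟩
    refine ⟨fun n => a n + b n, fun u => ?_⟩
    simpa [add_mul] using (ha u).add (hb u)
  mul_mem' := by
    rintro f g ⟨a, ha⟩ ⟨b, hb⟩
    let e : ℤ × ℤ ≃ ℤ × ℤ :=
      { toFun := fun p => (p.2, p.1 - p.2)
        invFun := fun p => (p.1 + p.2, p.1)
        left_inv := fun p => by simp
        right_inv := fun p => by simp }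
    have key : ∀ u : Kˣ, HasSum (fun p : ℤ × ℤ => a p.2 * b (p.1 - p.2) * (u : K) ^ p.1)
        (f u * g u) := fun u => by
      have hna : NonarchimedeanRing K :=
        { is_nonarchimedean := NonarchimedeanAddGroup.is_nonarchimedean }
      have h := (ha u).mul_of_nonarchimedean (hb u)
      rw [← e.hasSum_iff] at h
      convert h using 2 with p
      have hu : (u : K) ^ p.1 = (u : K) ^ p.2 * (u : K) ^ (p.1 - p.2) := by
        rw [← zpow_add₀ u.ne_zero, add_sub_cancel]
      simp only [Function.comp, e, Equiv.coe_fn_mk, hu]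
      ring_nf
    refine ⟨fun n => ∑' i, a i * b (n - i), fun u => (key u).prod_fiberwise fun n => ?_⟩
    have h1 := ((key 1).summable.prod_factor n).hasSum
    simp only [Units.val_one, one_zpow, mul_one] at h1
    exact h1.mul_right _
  algebraMap_mem' := by
    intro c
    refine ⟨fun n => if n = 0 then c else 0, fun u => ?_⟩
    have h := hasSum_single (f := fun n : ℤ => (if n = 0 then c else 0) * (u : K) ^ n) 0
      (fun n hn => by simp [hn])
    simpa using h

/-- The meromorphic functions on `Kˣ`: the quotient field of the ring of holomorphic functions. -/
abbrev Mero : Type _ := FractionRing (Holo K)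

variable {K}

/-- The coordinate function `u ↦ u`, as an invertible holomorphic function. -/
noncomputable def coord : (Holo K)ˣ where
  val := ⟨fun u => (u : K), fun n => if n = 1 then 1 else 0, fun u => by
    have h := hasSum_single (f := fun n : ℤ => (if n = 1 then (1 : K) else 0) * (u : K) ^ n) 1
      (fun n hn => by simp [hn])
    simpa using h⟩
  inv := ⟨fun u => ((u⁻¹ : Kˣ) : K), fun n => if n = -1 then 1 else 0, fun u => by
    have h := hasSum_single (f := fun n : ℤ => (if n = -1 then (1 : K) else 0) * (u : K) ^ n) (-1)
      (fun n hn => by simp [hn])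
    simpa using h⟩
  val_inv := by ext u; simp
  inv_val := by ext u; simp

/-- A polynomial, regarded as a holomorphic function on `Kˣ`. -/
noncomputable def ofPoly : K[X] →ₐ[K] Holo K := aeval (coord : (Holo K)ˣ).val

/-- The substitution `f(u) ↦ f(qu)` on holomorphic functions. -/
def shiftHom (q : Kˣ) : Holo K →+* Holo K where
  toFun f := ⟨fun u => f.1 (q * u), by
    obtain ⟨a, ha⟩ := f.2
    refine ⟨fun n => a n * (q : K) ^ n, fun u => ?_⟩
    simpa [mul_zpow, mul_assoc] using ha (q * u)⟩
  map_one' := rfl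
  map_mul' _ _ := rfl
  map_zero' := rfl
  map_add' _ _ := rfl

/-- The substitution `f(u) ↦ f(qu)` as an automorphism; its inverse is `f(u) ↦ f(q⁻¹u)`. -/
def shiftEquiv (q : Kˣ) : Holo K ≃+* Holo K :=
  RingEquiv.ofRingHom (shiftHom q) (shiftHom q⁻¹)
    (by ext f u; simp [shiftHom]) (by ext f u; simp [shiftHom])

/-- The substitution `f(u) ↦ f(qu)` on meromorphic functions. -/
noncomputable def shift (q : Kˣ) : Mero K ≃+* Mero K :=
  IsFractionRing.ringEquivOfRingEquiv (shiftEquiv q)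

/-- `f` is a (meromorphic) theta function with respect to `q^ℤ`: there are `c ∈ Kˣ`, `r ∈ ℤ` with
`f(u) = c u^r f(qu)`. -/
def IsTheta (q : Kˣ) (f : Mero K) : Prop :=
  ∃ (c : Kˣ) (r : ℤ),
    f = (c : K) • (algebraMap (Holo K) (Mero K) ((coord ^ r : (Holo K)ˣ) : Holo K) * shift q f)

/-- `v` is the value at `u` of the meromorphic function `f`: one can write `f = g / h` with `g`, `h`
holomorphic, `h(u) ≠ 0` and `v = g(u) / h(u)`. -/
def HasValue (f : Mero K) (u : Kˣ) (v : K) : Prop :=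
  ∃ g h : Holo K, h.1 u ≠ 0 ∧
    f * algebraMap (Holo K) (Mero K) h = algebraMap (Holo K) (Mero K) g ∧ v = g.1 u / h.1 u

theorem HasValue.unique {f : Mero K} {u : Kˣ} {v w : K} (hv : HasValue f u v)
    (hw : HasValue f u w) : v = w := by
  obtain ⟨g, h, h0, hf, rfl⟩ := hv
  obtain ⟨g', h', h0', hf', rfl⟩ := hw
  have e : g * h' = g' * h := by
    apply IsFractionRing.injective (Holo K) (Mero K)
    rw [map_mul, map_mul, ← hf, ← hf', mul_right_comm]
  have e' : g.1 u * h'.1 u = g'.1 u * h.1 u := congrFun (congrArg Subtype.val e) u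
  rw [div_eq_div_iff h0 h0', e']

open Classical in
/-- The value `f(u)` of a meromorphic function (with the convention `0` at a pole). -/
noncomputable def eval (f : Mero K) (u : Kˣ) : K :=
  if h : ∃ v, HasValue f u v then h.choose else 0

theorem HasValue.eval_eq {f : Mero K} {u : Kˣ} {v : K} (h : HasValue f u v) : eval f u = v := by
  have h' : ∃ v, HasValue f u v := ⟨v, h⟩
  rw [eval, dif_pos h']
  exact h'.choose_spec.unique h

/-- The order of the meromorphic function `f` along the irreducible polynomial `P` (that is, at the
`Gal`-orbit of the roots of `P` in the algebraic closure of `K`; for `P = X - a`, at the point `a`)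
is `n`: one can write `f = P ^ n * g / h` with `g` and `h` holomorphic and not divisible by `P`. -/
def HasOrder (f : Mero K) (P : K[X]) (n : ℤ) : Prop :=
  ∃ (g h : Holo K) (i j : ℕ), ¬ ofPoly P ∣ g ∧ ¬ ofPoly P ∣ h ∧ n = (i : ℤ) - (j : ℤ) ∧
    f * algebraMap (Holo K) (Mero K) (h * ofPoly P ^ j) =
      algebraMap (Holo K) (Mero K) (g * ofPoly P ^ i)

/-- The group of points `Kˣ / q^ℤ` of the Tate curve `E_q`. -/
abbrev TateCurve (q : Kˣ) : Type _ := Kˣ ⧸ Subgroup.zpowers q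

/-- `f` has divisor `D` on `E_q = Kˣ / q^ℤ`: at each point `a ∈ Kˣ` its order is the coefficient of
`D` at the class of `a`, and `f` has no zeros or poles outside `Kˣ`, that is, at points of
algebraic extensions of `K` that are not rational over `K`. -/
structure HasDivisor (q : Kˣ) (f : Mero K) (D : TateCurve q →₀ ℤ) : Prop where
  order_rational : ∀ a : Kˣ, HasOrder f (X - C (a : K)) (D (a : TateCurve q))
  order_nonrational : ∀ P : K[X], Irreducible P → (∀ a : K, ¬ P.IsRoot a) → HasOrder f P 0

end TateTheta

/-! Put θ_b(u) = (1 - u/b) ∏_{k≥1} (1 - q^k u/b)(1 - q^k b/u). Since |q| < 1 this is holomorphic,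
its zeros are simple and fill exactly b q^ℤ, and θ_b(qu) = -(b/u) θ_b(u). So f = c θ_1/θ_b satisfies
f(u) = b f(qu) and has divisor (1) - (b); a suitable c gives f(u) ~ 1 - u at u = 1. Replacing b by b
q^m would change f by a power of u, so f_Q is built from one fixed representative b of the class of
Q, and μ = 1 works.

Two points need more than these formulas. Holomorphic functions are functions on Kˣ, so their
Laurent coefficients must be shown unique (`coeff_eq_zero_of_hasSum_zero`): the values at powers of
1 + p are moments of the coefficients, and polynomials are dense in C(ℤ_p, ℤ_p) by Mahler's theorem.
This makes evaluation in extensions well defined and θ_b a non-zero-divisor. Second, no irreducible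
P without roots in K divides θ_b (`not_ofPoly_dvd_theta`): at a root of P in K[X]/(P), complete for
the spectral norm, θ_b does not vanish, because all its zeros lie in K. -/

namespace TateTheta

/-! ### The entire function E(u) = ∏_{k≥0} (1 - q^k u) -/

section Euler

variable {F : Type*} [NormedField F] [IsUltrametricDist F]

theorem norm_one_sub_pow_succ {q : F} (hq : ‖q‖ < 1) (n : ℕ) : ‖1 - q ^ (n + 1)‖ = 1 := by
  have h : ‖q ^ (n + 1)‖ < 1 := by
    rw [norm_pow]; exact pow_lt_one₀ (norm_nonneg _) hq n.succ_ne_zero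
  have h' : ‖(1 : F)‖ ≠ ‖-q ^ (n + 1)‖ := by rw [norm_one, norm_neg]; exact h.ne'
  rw [sub_eq_add_neg, IsUltrametricDist.norm_add_eq_max_of_norm_ne_norm h', norm_one, norm_neg,
    max_eq_left h.le]

/-- The coefficients of the power series expansion of `∏_{k ≥ 0} (1 - q^k u)`. -/
def eulerCoeff (q : F) : ℕ → F
  | 0 => 1
  | n + 1 => -q ^ n / (1 - q ^ (n + 1)) * eulerCoeff q n

/-- This is the comparison of coefficients of u^(n+1) in E(u) = (1 - u) E(qu). -/
theorem eulerCoeff_succ_mul {q : F} (hq : ‖q‖ < 1) (n : ℕ) :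
    eulerCoeff q (n + 1) * (1 - q ^ (n + 1)) = -q ^ n * eulerCoeff q n := by
  have h : 1 - q ^ (n + 1) ≠ 0 := norm_ne_zero_iff.1 (by rw [norm_one_sub_pow_succ hq]; simp)
  rw [eulerCoeff]
  field_simp

theorem norm_eulerCoeff_succ {q : F} (hq : ‖q‖ < 1) (n : ℕ) :
    ‖eulerCoeff q (n + 1)‖ = ‖q‖ ^ n * ‖eulerCoeff q n‖ := by
  simp [eulerCoeff, norm_one_sub_pow_succ hq]

theorem norm_eulerCoeff_le_one {q : F} (hq : ‖q‖ < 1) (n : ℕ) : ‖eulerCoeff q n‖ ≤ 1 := by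
  induction n with
  | zero => simp [eulerCoeff]
  | succ n ih =>
    rw [norm_eulerCoeff_succ hq]
    exact mul_le_one₀ (pow_le_one₀ (norm_nonneg _) hq.le) (norm_nonneg _) ih

variable [CompleteSpace F]

theorem summable_eulerCoeff {q : F} (hq : ‖q‖ < 1) (u : F) :
    Summable fun n => eulerCoeff q n * u ^ n := by
  refine summable_of_ratio_norm_eventually_le (r := 1 / 2) (by norm_num) ?_
  have h : Tendsto (fun n => ‖q‖ ^ n * ‖u‖) atTop (𝓝 (0 * ‖u‖)) :=
    (tendsto_pow_atTop_nhds_zero_of_lt_one (norm_nonneg _) hq).mul_const _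
  rw [zero_mul] at h
  filter_upwards [h.eventually_lt_const (by norm_num : (0 : ℝ) < 1 / 2)] with n hn
  calc ‖eulerCoeff q (n + 1) * u ^ (n + 1)‖
      = ‖q‖ ^ n * ‖u‖ * ‖eulerCoeff q n * u ^ n‖ := by
        rw [norm_mul, norm_eulerCoeff_succ hq, norm_mul, norm_pow, norm_pow]; ring
    _ ≤ 1 / 2 * ‖eulerCoeff q n * u ^ n‖ := by gcongr

/-- The sum of the series `∑ eₙ uⁿ` with coefficients `eulerCoeff q`, which is the entire function
`∏_{k ≥ 0} (1 - q^k u)`. -/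
noncomputable def euler (q u : F) : F := ∑' n, eulerCoeff q n * u ^ n

theorem hasSum_euler {q : F} (hq : ‖q‖ < 1) (u : F) :
    HasSum (fun n => eulerCoeff q n * u ^ n) (euler q u) := (summable_eulerCoeff hq u).hasSum

theorem euler_eq_mul {q : F} (hq : ‖q‖ < 1) (u : F) :
    euler q u = (1 - u) * euler q (q * u) := by
  have h1 := (hasSum_euler hq u).sub (hasSum_euler hq (q * u))
  -- The constant terms of E(u) and E(qu) cancel; what remains is -u E(qu), shifted by one.
  have h2 := (hasSum_nat_add_iff' 1).2 h1
  have h3 := (hasSum_euler hq (q * u)).mul_left (-u)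
  have h4 := h2.unique (h3.congr_fun ?_)
  · simp only [Finset.range_one, Finset.sum_singleton, pow_zero, mul_one, sub_self, sub_zero] at h4
    linear_combination h4
  · intro n
    rw [mul_pow, mul_pow]
    linear_combination u ^ (n + 1) * eulerCoeff_succ_mul hq n

theorem euler_eq_prod_mul {q : F} (hq : ‖q‖ < 1) (u : F) (N : ℕ) :
    euler q u = (∏ k ∈ Finset.range N, (1 - q ^ k * u)) * euler q (q ^ N * u) := by
  induction N with
  | zero => simp
  | succ N ih =>
    rw [ih, Finset.prod_range_succ, euler_eq_mul hq (q ^ N * u), pow_succ', mul_assoc, mul_assoc]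

/-- The constant term 1 dominates: every other term has norm at most |u| < 1. -/
theorem euler_ne_zero_of_norm_lt_one {q u : F} (hq : ‖q‖ < 1) (hu : ‖u‖ < 1) :
    euler q u ≠ 0 := by
  intro h0
  have h := (hasSum_nat_add_iff' 1).2 (hasSum_euler hq u)
  simp only [Finset.range_one, Finset.sum_singleton, pow_zero, mul_one, h0,
    show eulerCoeff q 0 = 1 from rfl] at h
  have h' : ‖(0 - 1 : F)‖ ≤ ‖u‖ := by
    rw [← h.tsum_eq]
    refine IsUltrametricDist.norm_tsum_le_of_forall_le_of_nonneg (norm_nonneg _) fun n => ?_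
    rw [norm_mul, norm_pow]
    calc _ ≤ 1 * (1 * ‖u‖) := by
          rw [pow_succ ‖u‖]
          gcongr
          · exact norm_eulerCoeff_le_one hq (n + 1)
          · exact pow_le_one₀ (norm_nonneg _) hu.le
      _ = ‖u‖ := by ring
  simp at h'
  linarith

/-- Split off factors until |q^N u| < 1, where the previous lemma applies. -/
theorem euler_ne_zero {q u : F} (hq : ‖q‖ < 1) (hu : ∀ k : ℕ, q ^ k * u ≠ 1) :
    euler q u ≠ 0 := by
  have h : Tendsto (fun n => ‖q‖ ^ n * ‖u‖) atTop (𝓝 (0 * ‖u‖)) :=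
    (tendsto_pow_atTop_nhds_zero_of_lt_one (norm_nonneg _) hq).mul_const _
  rw [zero_mul] at h
  obtain ⟨N, hN⟩ := (h.eventually_lt_const one_pos).exists
  rw [euler_eq_prod_mul hq u N]
  refine mul_ne_zero (Finset.prod_ne_zero_iff.2 fun k _ => sub_ne_zero.2 (hu k).symm)
    (euler_ne_zero_of_norm_lt_one hq ?_)
  rwa [norm_mul, norm_pow]

end Euler

theorem algebraMap_eulerCoeff {K L : Type*} [NormedField K] [NormedField L] [Algebra K L] (q : K)
    (n : ℕ) : algebraMap K L (eulerCoeff q n) = eulerCoeff (algebraMap K L q) n := by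
  induction n with
  | zero => simp [eulerCoeff]
  | succ n ih => simp [eulerCoeff, ih]

/-! ### Products of two-sided Laurent series at a point -/

section Laurent

variable {F : Type*} [NormedField F]

theorem hasSum_extend_mul_zpow {σ : ℕ → ℤ} (hσ : σ.Injective) {c : ℕ → F} {u s : F}
    (h : HasSum (fun n => c n * u ^ σ n) s) :
    HasSum (fun n => Function.extend σ c 0 n * u ^ n) s := by
  refine (hσ.hasSum_iff fun n hn => ?_).1 (by simpa [Function.comp_def, hσ.extend_apply] using h)
  rw [Function.extend_apply' _ _ _ hn, Pi.zero_apply, zero_mul]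

/-- Working at a single point of an arbitrary complete ultrametric field lets the product formula be
used at points of extensions of K. -/
theorem hasSum_mul_zpow [IsUltrametricDist F] [CompleteSpace F] {a b : ℤ → F} {u x y : F}
    (hu : u ≠ 0)
    (ha : HasSum (fun n => a n * u ^ n) x) (hb : HasSum (fun n => b n * u ^ n) y) :
    HasSum (fun n => (∑' i, a i * b (n - i)) * u ^ n) (x * y) := by
  let e : ℤ × ℤ ≃ ℤ × ℤ :=
    { toFun := fun p => (p.2, p.1 - p.2)
      invFun := fun p => (p.1 + p.2, p.1)
      left_inv := fun p => by simp
      right_inv := fun p => by simp }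
  have key : HasSum (fun p : ℤ × ℤ => a p.2 * b (p.1 - p.2) * u ^ p.1) (x * y) := by
    have hna : NonarchimedeanRing F :=
      { is_nonarchimedean := NonarchimedeanAddGroup.is_nonarchimedean }
    have h := ha.mul_of_nonarchimedean hb
    rw [← e.hasSum_iff] at h
    convert h using 2 with p
    have hu : u ^ p.1 = u ^ p.2 * u ^ (p.1 - p.2) := by
      rw [← zpow_add₀ hu, add_sub_cancel]
    simp only [Function.comp, e, Equiv.coe_fn_mk, hu]
    ring
  refine key.prod_fiberwise fun n => ?_
  rw [← tsum_mul_right]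
  exact (key.summable.prod_factor n).hasSum

theorem summable_convolution [IsUltrametricDist F] [CompleteSpace F] {a b : ℤ → F} {u : F}
    (hu : u ≠ 0)
    (ha : Summable (fun n => a n * u ^ n)) (hb : Summable (fun n => b n * u ^ n)) (n : ℤ) :
    Summable fun i => a i * b (n - i) := by
  rw [← summable_mul_right_iff (zpow_ne_zero n hu)]
  have hna : NonarchimedeanRing F :=
    { is_nonarchimedean := NonarchimedeanAddGroup.is_nonarchimedean }
  have h := ha.mul_of_nonarchimedean hb
  have hi : Function.Injective fun i : ℤ => (i, n - i) := fun i j h => (Prod.ext_iff.1 h).1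
  refine (h.comp_injective hi).congr fun i => ?_
  have hu : u ^ n = u ^ i * u ^ (n - i) := by
    rw [← zpow_add₀ hu, add_sub_cancel]
  simp only [Function.comp, hu]
  ring

end Laurent

/-! ### Vanishing moments over ℤ_p -/

section Moments

variable {p : ℕ} [hp : Fact p.Prime]

/-- Take a partial sum of the Mahler series; each binomial coefficient is a polynomial in x over
ℚ_p. -/
theorem exists_polynomial_norm_sub_lt (f : C(ℤ_[p], ℤ_[p])) {ε : ℝ} (hε : 0 < ε) :
    ∃ P : ℚ_[p][X], ∀ x : ℤ_[p], ‖(f x : ℚ_[p]) - P.eval (x : ℚ_[p])‖ < ε := by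
  have hm : ∀ k, ∃ P : ℚ_[p][X],
      ∀ x : ℤ_[p], ((mahler k x : ℤ_[p]) : ℚ_[p]) = P.eval (x : ℚ_[p]) := by
    intro k
    refine ⟨C ((k.factorial : ℚ_[p])⁻¹) * (descPochhammer ℤ k).map (Int.castRingHom _),
      fun x => ?_⟩
    have h := congrArg PadicInt.Coe.ringHom (Ring.descPochhammer_eq_factorial_smul_choose x k)
    have h0 : (k.factorial : ℚ_[p]) ≠ 0 := by exact_mod_cast k.factorial_ne_zero
    rw [← aeval_eq_smeval, aeval_def, hom_eval₂, map_nsmul, nsmul_eq_mul] at h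
    rw [mahler_apply, eval_mul, eval_C, eq_inv_mul_iff_mul_eq₀ h0, eval_map]
    exact h.symm
  choose P hP using hm
  obtain ⟨s, hs⟩ := ((PadicInt.hasSum_mahler f).eventually (Metric.ball_mem_nhds f hε)).exists
  refine ⟨∑ k ∈ s, C (((fwdDiff 1)^[k] f 0 : ℤ_[p]) : ℚ_[p]) * P k, fun x => ?_⟩
  rw [dist_comm, dist_eq_norm] at hs
  have h := ((f - _).norm_coe_le_norm x).trans_lt hs
  rw [PadicInt.norm_def] at h
  refine lt_of_eq_of_lt (congrArg _ (Eq.symm ?_)) h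
  rw [ContinuousMap.sub_apply, ContinuousMap.sum_apply, PadicInt.coe_sub, PadicInt.coe_sum,
    eval_finsetSum]
  congr 1
  refine Finset.sum_congr rfl fun k _ => ?_
  rw [PadicInt.mahlerTerm_apply, smul_eq_mul, PadicInt.coe_mul, eval_mul, eval_C, hP, mul_comm]

variable {K : Type*} [NormedField K] [NormedAlgebra ℚ_[p] K] [IsUltrametricDist K]

/-- By linearity ∑ a_n P(x_n) = 0 for every polynomial P. Let P approximate the indicator of a ball
around x_m that avoids the finitely many other x_n with |a_n| ≥ ε; the ultrametric inequality then
leaves |a_m| ≤ ε. -/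
theorem eq_zero_of_hasSum_mul_pow {ι : Type*} {a : ι → K} (ha : Tendsto a cofinite (𝓝 0))
    {x : ι → ℤ_[p]} (hx : x.Injective)
    (h : ∀ i : ℕ, HasSum (fun n => a n * algebraMap ℚ_[p] K (x n) ^ i) 0) (m : ι) : a m = 0 := by
  classical
  have hpoly : ∀ P : ℚ_[p][X],
      HasSum (fun n => a n * algebraMap ℚ_[p] K (P.eval (x n : ℚ_[p]))) 0 := by
    intro P
    have hs := hasSum_sum (s := Finset.range (P.natDegree + 1))
      fun i _ => (h i).mul_left (algebraMap ℚ_[p] K (P.coeff i))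
    simp only [mul_zero, Finset.sum_const_zero] at hs
    refine hs.congr_fun fun n => ?_
    rw [eval_eq_sum_range, map_sum, Finset.mul_sum]
    refine Finset.sum_congr rfl fun i _ => ?_
    rw [map_mul, map_pow]
    ring
  obtain ⟨M, hM⟩ := ha.norm.bddAbove_range_of_cofinite
  have hM' : ∀ n, ‖a n‖ ≤ M := fun n => hM ⟨n, rfl⟩
  have hM0 : 0 ≤ M := (norm_nonneg _).trans (hM' m)
  refine norm_le_zero_iff.1 (le_of_forall_pos_le_add fun ε hε => ?_)
  rw [zero_add]
  have hT : {n | ¬ ‖a n‖ < ε}.Finite := by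
    have := ha.norm.eventually_lt_const (by simpa using hε : ‖(0 : K)‖ < ε)
    simpa [Filter.eventually_cofinite] using this
  have hT' : IsOpen (x '' ({n | ¬ ‖a n‖ < ε} \ {m}))ᶜ :=
    ((hT.sdiff).image x).isClosed.isOpen_compl
  obtain ⟨r, hr, hball⟩ := Metric.isOpen_iff.1 hT' (x m) (by
    rintro ⟨n, hn, he⟩
    exact hn.2 (hx he))
  let f : C(ℤ_[p], ℤ_[p]) := ⟨(Metric.ball (x m) r).indicator 1,
    (IsUltrametricDist.isClopen_ball (x m) r).continuous_indicator continuous_one⟩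
  -- The bound 1 keeps |P(x_n)| ≤ 1 where a_n is already small; the other bound controls the error
  -- at x_m and at the other large a_n. Using M + 1 avoids division by 0.
  have hδ : 0 < min 1 (ε / (M + 1)) := by positivity
  obtain ⟨P, hP⟩ := exists_polynomial_norm_sub_lt f hδ
  have hsmall : ∀ (n : ι) (y : ℚ_[p]), ‖y‖ < min 1 (ε / (M + 1)) →
      ‖a n * algebraMap ℚ_[p] K y‖ ≤ ε := by
    intro n y hy
    rw [norm_mul, norm_algebraMap']
    calc _ ≤ (M + 1) * (ε / (M + 1)) := by
          gcongr
          · linarith [hM' n]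
          · exact (hy.trans_le (min_le_right _ _)).le
      _ = ε := by field_simp
  have key := (hpoly P).sub (hasSum_ite_eq m (a m))
  rw [zero_sub] at key
  rw [← norm_neg, ← key.tsum_eq]
  refine IsUltrametricDist.norm_tsum_le_of_forall_le_of_nonneg hε.le fun n => ?_
  by_cases hnm : n = m
  · subst hnm
    have h1 : f (x n) = 1 := by
      change (Metric.ball (x n) r).indicator 1 (x n) = 1
      rw [Set.indicator_of_mem (Metric.mem_ball_self hr)]; rfl
    have h2 := hP (x n)
    rw [h1, norm_sub_rev] at h2
    have h3 := hsmall n _ h2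
    rw [map_sub, PadicInt.coe_one, map_one, mul_sub, mul_one] at h3
    simpa using h3
  rw [if_neg hnm, sub_zero]
  by_cases hn : ‖a n‖ < ε
  · have h1 : ‖P.eval (x n : ℚ_[p])‖ ≤ 1 := by
      have h2 := IsUltrametricDist.norm_add_le_max (f (x n) : ℚ_[p])
        (-((f (x n) : ℚ_[p]) - P.eval (x n : ℚ_[p])))
      rw [← sub_eq_add_neg, sub_sub_cancel, norm_neg] at h2
      exact h2.trans (max_le (PadicInt.norm_le_one _)
        ((hP (x n)).trans_le (min_le_left _ _)).le)
    rw [norm_mul, norm_algebraMap']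
    exact (mul_le_of_le_one_right (norm_nonneg _) h1).trans hn.le
  · have h1 : f (x n) = 0 := Set.indicator_of_notMem
      (fun hmem => hball hmem ⟨n, ⟨hn, hnm⟩, rfl⟩) _
    have h2 := hP (x n)
    rw [h1, PadicInt.coe_zero, zero_sub, norm_neg] at h2
    exact hsmall n _ h2

end Moments

/-! ### Uniqueness of Laurent coefficients -/

section Uniqueness

variable {p : ℕ} [hp : Fact p.Prime]

theorem norm_one_add_natCast_prime : ‖(1 + p : ℚ_[p])‖ = 1 := by
  have h : ‖(1 : ℚ_[p])‖ ≠ ‖(p : ℚ_[p])‖ := by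
    rw [norm_one]; exact Padic.norm_p_lt_one.ne'
  rw [IsUltrametricDist.norm_add_eq_max_of_norm_ne_norm h, norm_one,
    max_eq_left Padic.norm_p_lt_one.le]

variable (p) in
-- The comparison takes place in ℚ, where 1 + p > 1.
theorem one_add_natCast_prime_zpow_injective :
    Function.Injective fun n : ℤ => (1 + p : ℚ_[p]) ^ n := by
  intro m n h
  have h1 : (1 : ℚ) < 1 + p := by
    have : (0 : ℚ) < p := by exact_mod_cast hp.out.pos
    linarith
  refine zpow_right_injective₀ (zero_lt_one.trans h1) h1.ne' ?_
  have h2 : (((1 + p : ℚ) ^ m : ℚ) : ℚ_[p]) = (((1 + p : ℚ) ^ n : ℚ) : ℚ_[p]) := by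
    push_cast; exact h
  exact_mod_cast h2

variable {K : Type*} [NormedField K] [NormedAlgebra ℚ_[p] K] [IsUltrametricDist K]

/-- With λ = 1 + p, the term a_n (λ^(i+1))^n equals (a_n λ^n)(λ^n)^i, so the hypothesis says that
all moments of a_n λ^n at the distinct points λ^n of ℤ_p vanish. The exponent i + 1 leaves out the
point u = 1, where θ_1 vanishes. -/
theorem coeff_eq_zero_of_hasSum_zero {a : ℤ → K} (ha : Summable a)
    (h : ∀ i : ℕ, HasSum (fun n => a n * (algebraMap ℚ_[p] K (1 + p) ^ (i + 1)) ^ n) 0) :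
    a = 0 := by
  set lam := algebraMap ℚ_[p] K (1 + p) with hlam
  have hnorm : ‖lam‖ = 1 := by rw [hlam, norm_algebraMap', norm_one_add_natCast_prime]
  let x : ℤ → ℤ_[p] := fun n => ⟨(1 + p : ℚ_[p]) ^ n, by
    rw [norm_zpow, norm_one_add_natCast_prime, one_zpow]⟩
  have hx : x.Injective := fun m n hmn =>
    one_add_natCast_prime_zpow_injective p (congrArg Subtype.val hmn)
  have hax : ∀ n, algebraMap ℚ_[p] K (x n) = lam ^ n := fun n => map_zpow₀ _ _ _
  have hb : Tendsto (fun n => a n * lam ^ n) cofinite (𝓝 0) := by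
    rw [tendsto_zero_iff_norm_tendsto_zero]
    have := tendsto_zero_iff_norm_tendsto_zero.1 ha.tendsto_cofinite_zero
    simpa [norm_mul, norm_zpow, hnorm] using this
  funext m
  have h0 := eq_zero_of_hasSum_mul_pow hb hx (fun i => (h i).congr_fun fun n => ?_) m
  · refine (mul_eq_zero.1 h0).resolve_right (zpow_ne_zero _ ?_)
    exact norm_ne_zero_iff.1 (by rw [hnorm]; exact one_ne_zero)
  · rw [hax, pow_succ, mul_zpow, ← zpow_natCast (lam ^ n), ← zpow_natCast lam, zpow_comm]
    ring

/-- The unit `1 + p` of `K`. -/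
noncomputable def oneAddPrime (p : ℕ) [Fact p.Prime] (K : Type*) [NormedField K]
    [NormedAlgebra ℚ_[p] K] : Kˣ :=
  Units.mk0 (algebraMap ℚ_[p] K (1 + p)) <| by
    rw [← norm_ne_zero_iff, norm_algebraMap', norm_one_add_natCast_prime]
    exact one_ne_zero

section

variable (p) (K : Type*) [NormedField K] [NormedAlgebra ℚ_[p] K]

theorem oneAddPrime_pow_succ_ne_one (i : ℕ) : oneAddPrime p K ^ (i + 1) ≠ 1 := by
  intro h
  have h1 : algebraMap ℚ_[p] K ((1 + p) ^ (i + 1)) = algebraMap ℚ_[p] K 1 := by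
    simpa [oneAddPrime] using congrArg Units.val h
  have h2 : (1 + p : ℚ_[p]) ^ ((i + 1 : ℕ) : ℤ) = (1 + p : ℚ_[p]) ^ (0 : ℤ) := by
    rw [zpow_natCast, zpow_zero]
    exact (algebraMap ℚ_[p] K).injective h1
  have h3 := one_add_natCast_prime_zpow_injective p h2
  omega

theorem norm_oneAddPrime : ‖(oneAddPrime p K : K)‖ = 1 := by
  change ‖algebraMap ℚ_[p] K (1 + p)‖ = 1
  rw [norm_algebraMap', norm_one_add_natCast_prime]

end

variable [CompleteSpace K]

theorem Holo.eq_zero_of_eval_oneAddPrime {f : Holo K}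
    (h : ∀ i : ℕ, f.1 (oneAddPrime p K ^ (i + 1)) = 0) : f = 0 := by
  obtain ⟨a, ha⟩ := f.2
  have h0 : a = 0 := by
    refine coeff_eq_zero_of_hasSum_zero (p := p) ?_ fun i => ?_
    · simpa using (ha 1).summable
    · rw [← h i]
      simpa [oneAddPrime] using ha (oneAddPrime p K ^ (i + 1))
  ext u
  have := ha u
  rw [h0] at this
  simpa using this.unique (by simp)

end Uniqueness

/-! ### Evaluation at points of extension fields -/

section Eval

variable {K : Type*} [NormedField K] [IsUltrametricDist K]

theorem coeff_unique (p : ℕ) [Fact p.Prime] [NormedAlgebra ℚ_[p] K] {a b : ℤ → K} {f : Kˣ → K}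
    (ha : ∀ u : Kˣ, HasSum (fun n : ℤ => a n * (u : K) ^ n) (f u))
    (hb : ∀ u : Kˣ, HasSum (fun n : ℤ => b n * (u : K) ^ n) (f u)) : a = b := by
  have hab : ∀ u : Kˣ, HasSum (fun n : ℤ => (a - b) n * (u : K) ^ n) 0 := fun u => by
    simpa [sub_mul] using (ha u).sub (hb u)
  refine sub_eq_zero.1 (coeff_eq_zero_of_hasSum_zero (p := p) ?_ fun i => ?_)
  · simpa using! (hab 1).summable
  · simpa [oneAddPrime] using hab (oneAddPrime p K ^ (i + 1))

variable [CompleteSpace K]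

variable {L : Type*} [NormedField L] [NormedAlgebra K L]

/-- `x` is the value at `α` of the Laurent series that represents `f`. -/
def EvalsTo (f : Holo K) (α x : L) : Prop :=
  ∃ a : ℤ → K, (∀ u : Kˣ, HasSum (fun n : ℤ => a n * (u : K) ^ n) (f.1 u)) ∧
    HasSum (fun n => algebraMap K L (a n) * α ^ n) x

theorem EvalsTo.unique (p : ℕ) [Fact p.Prime] [NormedAlgebra ℚ_[p] K]
    {f : Holo K} {α x y : L} (hx : EvalsTo f α x) (hy : EvalsTo f α y) :
    x = y := by
  obtain ⟨a, ha, hax⟩ := hx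
  obtain ⟨b, hb, hby⟩ := hy
  rw [coeff_unique p ha hb] at hax
  exact hax.unique hby

theorem EvalsTo.add {f g : Holo K} {α x y : L} (hx : EvalsTo f α x)
    (hy : EvalsTo g α y) : EvalsTo (f + g) α (x + y) := by
  obtain ⟨a, ha, hax⟩ := hx
  obtain ⟨b, hb, hby⟩ := hy
  refine ⟨a + b, fun u => ?_, ?_⟩
  · simpa [add_mul] using (ha u).add (hb u)
  · simpa [add_mul] using hax.add hby

theorem evalsTo_algebraMap (c : K) (α : L) :
    EvalsTo (algebraMap K (Holo K) c) α (algebraMap K L c) := by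
  refine ⟨fun n => if n = 0 then c else 0, fun u => ?_, ?_⟩
  · have h := hasSum_single (f := fun n : ℤ => (if n = 0 then c else 0) * (u : K) ^ n) 0
      (fun n hn => by simp [hn])
    simpa using h
  · have h := hasSum_single
      (f := fun n : ℤ => algebraMap K L (if n = 0 then c else 0) * α ^ n) 0
      (fun n hn => by simp [hn])
    simpa using h

theorem evalsTo_coord (α : L) : EvalsTo (coord : (Holo K)ˣ).val α α := by
  refine ⟨fun n => if n = 1 then 1 else 0, fun u => ?_, ?_⟩
  · have h := hasSum_single (f := fun n : ℤ => (if n = 1 then (1 : K) else 0) * (u : K) ^ n) 1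
      (fun n hn => by simp [hn])
    simpa [coord] using h
  · have h := hasSum_single
      (f := fun n : ℤ => algebraMap K L (if n = 1 then 1 else 0) * α ^ n) 1
      (fun n hn => by simp [hn])
    simpa using h

variable [IsUltrametricDist L] [CompleteSpace L]

theorem EvalsTo.mul {f g : Holo K} {α x y : L} (hα : α ≠ 0) (hx : EvalsTo f α x)
    (hy : EvalsTo g α y) : EvalsTo (f * g) α (x * y) := by
  obtain ⟨a, ha, hax⟩ := hx
  obtain ⟨b, hb, hby⟩ := hy
  refine ⟨fun n => ∑' i, a i * b (n - i), fun u => hasSum_mul_zpow u.ne_zero (ha u) (hb u), ?_⟩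
  have h := hasSum_mul_zpow (a := fun n => algebraMap K L (a n))
    (b := fun n => algebraMap K L (b n)) hα hax hby
  refine h.congr_fun fun n => ?_
  have hs : Summable fun i => a i * b (n - i) :=
    summable_convolution (u := ((1 : Kˣ) : K)) (Units.ne_zero 1) (ha 1).summable (hb 1).summable n
  rw [hs.map_tsum (algebraMap K L) (continuous_algebraMap K L)]
  simp only [map_mul]

theorem evalsTo_ofPoly {α : L} (hα : α ≠ 0) (P : K[X]) : EvalsTo (ofPoly P) α (aeval α P) := by
  induction P using Polynomial.induction_on' with
  | add P Q hP hQ => simpa using hP.add hQ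
  | monomial n c =>
    induction n with
    | zero => simpa [ofPoly] using evalsTo_algebraMap c α
    | succ n ih =>
      have h := ih.mul hα (evalsTo_coord α)
      rw [← monomial_mul_X]
      simpa only [ofPoly, map_mul, aeval_X] using h

/-- Powers of p squeeze |α| between the norms of two points of Kˣ. The inner one bounds the terms
with n ≤ 0, the outer one those with n ≥ 0, and terms tending to 0 suffice for summability. -/
theorem exists_evalsTo (p : ℕ) [Fact p.Prime] [NormedAlgebra ℚ_[p] K]
    (f : Holo K) {α : L} (hα : α ≠ 0) : ∃ x, EvalsTo f α x := by
  obtain ⟨a, ha⟩ := f.2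
  have hp1 : ‖algebraMap ℚ_[p] K p‖ < 1 := by
    rw [norm_algebraMap']; exact Padic.norm_p_lt_one
  have hp0 : algebraMap ℚ_[p] K p ≠ 0 := by
    rw [_root_.map_ne_zero]
    exact_mod_cast (Fact.out : p.Prime).ne_zero
  let π : Kˣ := Units.mk0 _ hp0
  have hπ : ‖(π : K)‖ < 1 := hp1
  obtain ⟨m, hm⟩ := exists_pow_lt_of_lt_one (norm_pos_iff.2 hα) hπ
  obtain ⟨M, hM⟩ := exists_pow_lt_of_lt_one (inv_pos.2 (norm_pos_iff.2 hα)) hπ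
  have hbound : ∀ n : ℤ, ‖algebraMap K L (a n) * α ^ n‖ ≤
      ‖a n * ((π ^ m : Kˣ) : K) ^ n‖ + ‖a n * (((π ^ M)⁻¹ : Kˣ) : K) ^ n‖ := by
    intro n
    simp only [norm_mul, norm_zpow, norm_algebraMap']
    rcases le_total 0 n with hn | hn
    · refine le_add_of_nonneg_of_le (by positivity) ?_
      gcongr
      refine zpow_le_zpow_left₀ hn (norm_nonneg _) ?_
      rw [Units.val_inv_eq_inv_val, norm_inv, Units.val_pow_eq_pow_val, norm_pow]
      exact (le_inv_comm₀ (norm_pos_iff.2 hα) (pow_pos (norm_pos_iff.2 π.ne_zero) _)).2 hM.le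
    · refine le_add_of_le_of_nonneg ?_ (by positivity)
      gcongr
      obtain ⟨k, rfl⟩ := Int.eq_ofNat_of_zero_le (neg_nonneg.2 hn) |>.imp fun k hk => neg_eq_iff_eq_neg.1 hk
      simp only [zpow_neg, zpow_natCast]
      have : 0 < ‖((π ^ m : Kˣ) : K)‖ := norm_pos_iff.2 (π ^ m).ne_zero
      gcongr
      rw [Units.val_pow_eq_pow_val, norm_pow]
      exact hm.le
  have hs : Summable fun n => algebraMap K L (a n) * α ^ n := by
    refine NonarchimedeanAddGroup.summable_of_tendsto_cofinite_zero ?_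
    refine squeeze_zero_norm hbound ?_
    simpa using ((ha (π ^ m)).summable.tendsto_cofinite_zero.norm).add
      ((ha (π ^ M)⁻¹).summable.tendsto_cofinite_zero.norm)
  exact ⟨_, a, ha, hs.hasSum⟩

theorem EvalsTo.eq_zero_of_ofPoly_dvd (p : ℕ) [Fact p.Prime] [NormedAlgebra ℚ_[p] K]
    {P : K[X]} {f : Holo K} {α x : L} (hα : α ≠ 0)
    (hP : aeval α P = 0) (hdvd : ofPoly P ∣ f) (hx : EvalsTo f α x) : x = 0 := by
  obtain ⟨k, rfl⟩ := hdvd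
  obtain ⟨y, hy⟩ := exists_evalsTo p k hα
  rw [hx.unique p ((evalsTo_ofPoly hα P).mul hα hy), hP, zero_mul]

end Eval

/-! ### The theta functions and their zeros -/

section Theta

theorem hasSum_algebraMap_extend_mul_zpow {K L : Type*} [NormedField K] [NormedField L]
    [Algebra K L] {σ : ℕ → ℤ} (hσ : σ.Injective) {c : ℕ → K} {α s : L}
    (h : HasSum (fun n => algebraMap K L (c n) * α ^ σ n) s) :
    HasSum (fun n => algebraMap K L (Function.extend σ c 0 n) * α ^ n) s := by
  refine (hasSum_extend_mul_zpow hσ h).congr_fun fun n => ?_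
  rw [Function.apply_extend (algebraMap K L)]
  congr 2
  funext
  simp

theorem zpow_ne_one_of_norm_lt_one {K : Type*} [NormedField K] {q : Kˣ}
    (hq : ‖(q : K)‖ < 1) {m : ℤ} (hm : m ≠ 0) : q ^ m ≠ 1 := by
  intro h
  have h1 : ‖(q : K)‖ ^ m = 1 := by
    rw [← norm_zpow, ← Units.val_zpow_eq_zpow_val, h, Units.val_one, norm_one]
  exact hm ((zpow_eq_one_iff_right₀ (norm_nonneg _) hq.ne).1 h1)
theorem mk_eq_mk_of_eq_mul_zpow {K : Type*} [NormedField K] {q b u : Kˣ} {m : ℤ} (h : u = b * q ^ m) :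
    (u : TateCurve q) = (b : TateCurve q) :=
  (QuotientGroup.eq.2 (Subgroup.mem_zpowers_iff.2 ⟨m, by rw [h, inv_mul_cancel_left]⟩)).symm

variable {K : Type*} [NormedField K] [IsUltrametricDist K] [CompleteSpace K]

/-- The holomorphic function `∏_{k ≥ 0} (1 - q^k c u)`. -/
noncomputable def eulerHolo {q : Kˣ} (hq : ‖(q : K)‖ < 1) (c : K) : Holo K :=
  ⟨fun u => euler (q : K) (c * u),
    Function.extend ((↑) : ℕ → ℤ) (fun n => eulerCoeff (q : K) n * c ^ n) 0, fun u =>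
    hasSum_extend_mul_zpow Nat.cast_injective <| (hasSum_euler hq (c * u)).congr_fun fun n => by
      rw [zpow_natCast]; ring⟩

theorem neg_natCast_injective : Function.Injective fun n : ℕ => -(n : ℤ) :=
  neg_injective.comp Nat.cast_injective

/-- The holomorphic function `∏_{k ≥ 0} (1 - q^k c / u)`. -/
noncomputable def eulerInvHolo {q : Kˣ} (hq : ‖(q : K)‖ < 1) (c : K) : Holo K :=
  ⟨fun u => euler (q : K) (c * (u : K)⁻¹),
    Function.extend (fun n : ℕ => -(n : ℤ)) (fun n => eulerCoeff (q : K) n * c ^ n) 0, fun u =>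
    hasSum_extend_mul_zpow neg_natCast_injective <|
      (hasSum_euler hq (c * (u : K)⁻¹)).congr_fun fun n => by
        rw [zpow_neg, zpow_natCast, mul_pow, inv_pow]; ring⟩

/-- The holomorphic function `∏_{k ≥ 1} (1 - q^k u / b) (1 - q^k b / u)`. -/
noncomputable def thetaCofactor {q : Kˣ} (hq : ‖(q : K)‖ < 1) (b : Kˣ) : Holo K :=
  eulerHolo hq (q * (b : K)⁻¹) * eulerInvHolo hq (q * b)

/-- The theta function `(1 - u / b) ∏_{k ≥ 1} (1 - q^k u / b) (1 - q^k b / u)`. -/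
noncomputable def theta {q : Kˣ} (hq : ‖(q : K)‖ < 1) (b : Kˣ) : Holo K :=
  (1 - algebraMap K (Holo K) (b : K)⁻¹ * (coord : (Holo K)ˣ).val) * thetaCofactor hq b

section Values

variable {q : Kˣ} (hq : ‖(q : K)‖ < 1)

theorem coord_inv_apply (u : Kˣ) : (coord⁻¹ : (Holo K)ˣ).val.1 u = (u : K)⁻¹ :=
  Units.val_inv_eq_inv_val u

theorem thetaCofactor_apply (b u : Kˣ) : (thetaCofactor hq b).1 u =
    euler (q : K) (q * (b : K)⁻¹ * u) * euler (q : K) (q * b * (u : K)⁻¹) := rfl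

theorem theta_apply (b u : Kˣ) :
    (theta hq b).1 u = (1 - (b : K)⁻¹ * u) * (thetaCofactor hq b).1 u := rfl

theorem thetaCofactor_ne_zero {b u : Kˣ} (h : ∀ m : ℤ, m ≠ 0 → u ≠ b * q ^ m) :
    (thetaCofactor hq b).1 u ≠ 0 := by
  rw [thetaCofactor_apply]
  refine mul_ne_zero (euler_ne_zero hq fun k hk => ?_) (euler_ne_zero hq fun k hk => ?_)
  · refine h (-(k + 1 : ℤ)) (by omega) ?_
    rw [zpow_neg, zpow_add_one, zpow_natCast, eq_mul_inv_iff_mul_eq]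
    ext
    push_cast
    field_simp at hk
    linear_combination hk
  · refine h (k + 1 : ℤ) (by omega) ?_
    rw [zpow_add_one, zpow_natCast]
    ext
    push_cast
    field_simp at hk
    linear_combination -hk

theorem theta_ne_zero {b u : Kˣ} (h : (u : TateCurve q) ≠ b) : (theta hq b).1 u ≠ 0 := by
  rw [theta_apply]
  refine mul_ne_zero (fun h0 => h ?_) (thetaCofactor_ne_zero hq fun m _ hm =>
    h (mk_eq_mk_of_eq_mul_zpow hm))
  rw [sub_eq_zero, eq_inv_mul_iff_mul_eq₀ b.ne_zero, mul_one] at h0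
  rw [Units.ext h0]

theorem thetaCofactor_self_ne_zero (b : Kˣ) : (thetaCofactor hq b).1 b ≠ 0 :=
  thetaCofactor_ne_zero hq fun _ hm h => zpow_ne_one_of_norm_lt_one hq hm (left_eq_mul.1 h)

/-- The substitution shifts both products by one index: the factor 1 - u/b is lost and 1 - b/u is
gained, and their ratio is -b/u. -/
theorem shiftHom_theta (b : Kˣ) : shiftHom q (theta hq b) =
    algebraMap K (Holo K) (-b) * (coord⁻¹ : (Holo K)ˣ).val * theta hq b := by
  ext u
  change (theta hq b).1 (q * u) = -b * (coord⁻¹ : (Holo K)ˣ).val.1 u * (theta hq b).1 u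
  have hu := u.ne_zero
  have hb := b.ne_zero
  have hq0 := q.ne_zero
  have h1 := euler_eq_mul hq ((q : K) * (b : K)⁻¹ * u)
  have h2 := euler_eq_mul hq ((b : K) * (u : K)⁻¹)
  simp only [theta_apply, thetaCofactor_apply, coord_inv_apply, Units.val_mul]
  rw [h1, show (q : K) * b * (q * u : K)⁻¹ = b * (u : K)⁻¹ by field_simp, h2,
    show (q : K) * (b : K)⁻¹ * (q * u) = q * (q * (b : K)⁻¹ * u) by ring,
    show (q : K) * b * (u : K)⁻¹ = q * (b * (u : K)⁻¹) by ring]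
  field_simp
  ring

/-- Since u/b is unchanged when u and b are both multiplied by q, θ_b(u) = θ_{bq}(qu); then apply
quasi-periodicity. -/
theorem theta_eq_mul_theta_mul (b : Kˣ) : theta hq b =
    algebraMap K (Holo K) (-(b * q)) * (coord⁻¹ : (Holo K)ˣ).val * theta hq (b * q) := by
  ext u
  have h := congrFun (congrArg Subtype.val (shiftHom_theta hq (b * q))) u
  change (theta hq (b * q)).1 (q * u) = -(b * q : Kˣ) * _ * _ at h
  change _ = -(b * q : K) * (coord⁻¹ : (Holo K)ˣ).val.1 u * (theta hq (b * q)).1 u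
  rw [Units.val_mul] at h
  refine Eq.trans ?_ h
  have hq0 := q.ne_zero
  have hu := u.ne_zero
  have hb := b.ne_zero
  simp only [theta_apply, thetaCofactor_apply, Units.val_mul]
  rw [show (b * q : K)⁻¹ * (q * u) = (b : K)⁻¹ * u by field_simp,
    show (q : K) * (b * q : K)⁻¹ * (q * u) = q * (b : K)⁻¹ * u by field_simp,
    show (q : K) * (b * q) * (q * u : K)⁻¹ = q * b * (u : K)⁻¹ by field_simp]

theorem isUnit_algebraMap_holo {c : K} (hc : c ≠ 0) : IsUnit (algebraMap K (Holo K) c) :=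
  (isUnit_iff_ne_zero.2 hc).map _

theorem associated_theta_mul (b : Kˣ) : Associated (theta hq b) (theta hq (b * q)) := by
  rw [theta_eq_mul_theta_mul hq b]
  refine associated_unit_mul_left _ _ ((isUnit_algebraMap_holo ?_).mul (Units.isUnit _))
  exact neg_ne_zero.2 (mul_ne_zero b.ne_zero q.ne_zero)

theorem associated_theta_mul_zpow (b : Kˣ) (m : ℤ) :
    Associated (theta hq b) (theta hq (b * q ^ m)) := by
  induction m using Int.induction_on with
  | zero => simp
  | succ n ih => rw [zpow_add_one, ← mul_assoc]; exact ih.trans (associated_theta_mul hq _)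
  | pred n ih =>
    refine ih.trans (Associated.symm ?_)
    have h := associated_theta_mul hq (b * q ^ (-(n : ℤ) - 1))
    rwa [mul_assoc, ← zpow_add_one, sub_add_cancel] at h

theorem isUnit_apply_ne_zero {f : Holo K} (hf : IsUnit f) (u : Kˣ) : f.1 u ≠ 0 := by
  obtain ⟨w, rfl⟩ := hf
  have h : w.val.1 u * w.inv.1 u = 1 := congrFun (congrArg Subtype.val w.val_inv) u
  exact left_ne_zero_of_mul_eq_one h

theorem ofPoly_apply (P : K[X]) (u : Kˣ) : (ofPoly P).1 u = P.eval (u : K) := by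
  induction P using Polynomial.induction_on' with
  | add P Q hP hQ =>
    rw [map_add, eval_add, ← hP, ← hQ]; rfl
  | monomial n c =>
    rw [ofPoly, aeval_monomial, eval_monomial]; rfl

open Classical in
-- If a = b q^m, pass to the associate θ_a: its first factor is -(u - a)/a and its cofactor does not
-- vanish at a. This gives simplicity of the zeros.
theorem exists_theta_eq_mul_pow (b a : Kˣ) : ∃ g : Holo K, g.1 a ≠ 0 ∧
    theta hq b = g * ofPoly (X - C (a : K)) ^ (if (a : TateCurve q) = b then 1 else 0) := by
  split_ifs with h
  · obtain ⟨m, hm⟩ := Subgroup.mem_zpowers_iff.1 (QuotientGroup.eq.1 h.symm)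
    have ha : a = b * q ^ m := by rw [hm, mul_inv_cancel_left]
    obtain ⟨w, hw⟩ := (associated_theta_mul_zpow hq b m).symm
    rw [← ha] at hw
    refine ⟨w * algebraMap K (Holo K) (-(a : K)⁻¹) * thetaCofactor hq a, ?_, ?_⟩
    · refine mul_ne_zero (mul_ne_zero (isUnit_apply_ne_zero w.isUnit a) ?_)
        (thetaCofactor_self_ne_zero hq a)
      exact neg_ne_zero.2 (inv_ne_zero a.ne_zero)
    · rw [← hw]
      ext u
      change (1 - (a : K)⁻¹ * u) * (thetaCofactor hq a).1 u * w.val.1 u =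
        w.val.1 u * -(a : K)⁻¹ * (thetaCofactor hq a).1 u * (ofPoly (X - C (a : K)) ^ 1).1 u
      rw [pow_one, ofPoly_apply]
      have := a.ne_zero
      simp only [eval_sub, eval_X, eval_C]
      field_simp
      ring
  · exact ⟨theta hq b, theta_ne_zero hq h, by simp⟩

theorem not_ofPoly_dvd_of_apply_ne_zero {g : Holo K} {a : Kˣ} (hg : g.1 a ≠ 0) :
    ¬ ofPoly (X - C (a : K)) ∣ g := by
  rintro ⟨k, rfl⟩
  refine hg ?_
  change (ofPoly (X - C (a : K))).1 a * k.1 a = 0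
  rw [ofPoly_apply]
  simp

end Values

/-! ### Theta functions at non-rational points -/

section Extension

variable {L : Type*} [NormedField L] [NormedAlgebra K L] [IsUltrametricDist L] [CompleteSpace L]
variable {q : Kˣ} (hq : ‖(q : K)‖ < 1)

theorem evalsTo_eulerHolo (c : K) (α : L) : EvalsTo (eulerHolo hq c) α
    (euler (algebraMap K L q) (algebraMap K L c * α)) := by
  have hqL : ‖algebraMap K L q‖ < 1 := by rwa [norm_algebraMap']
  refine ⟨Function.extend ((↑) : ℕ → ℤ) (fun n => eulerCoeff (q : K) n * c ^ n) 0,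
    fun u => hasSum_extend_mul_zpow Nat.cast_injective <|
      (hasSum_euler hq (c * u)).congr_fun fun n => ?_,
    hasSum_algebraMap_extend_mul_zpow Nat.cast_injective <|
      (hasSum_euler hqL (algebraMap K L c * α)).congr_fun fun n => ?_⟩
  · rw [zpow_natCast]; ring
  · rw [zpow_natCast, map_mul, map_pow, algebraMap_eulerCoeff]; ring

theorem evalsTo_eulerInvHolo (c : K) (α : L) : EvalsTo (eulerInvHolo hq c) α
    (euler (algebraMap K L q) (algebraMap K L c * α⁻¹)) := by
  have hqL : ‖algebraMap K L q‖ < 1 := by rwa [norm_algebraMap']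
  refine ⟨Function.extend (fun n : ℕ => -(n : ℤ)) (fun n => eulerCoeff (q : K) n * c ^ n) 0,
    fun u => hasSum_extend_mul_zpow neg_natCast_injective <|
      (hasSum_euler hq (c * (u : K)⁻¹)).congr_fun fun n => ?_,
    hasSum_algebraMap_extend_mul_zpow neg_natCast_injective <|
      (hasSum_euler hqL (algebraMap K L c * α⁻¹)).congr_fun fun n => ?_⟩
  · rw [zpow_neg, zpow_natCast, mul_pow, inv_pow]; ring
  · rw [zpow_neg, zpow_natCast, map_mul, map_pow, algebraMap_eulerCoeff, mul_pow, inv_pow]; ring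

/-- A vanishing factor would force α = b q^m for some integer m, which lies in K. -/
theorem exists_evalsTo_theta_ne_zero (b : Kˣ) {α : L} (hα : α ∉ Set.range (algebraMap K L)) :
    ∃ x ≠ 0, EvalsTo (theta hq b) α x := by
  have hα0 : α ≠ 0 := fun h => hα ⟨0, by rw [h, map_zero]⟩
  have hqL : ‖algebraMap K L q‖ < 1 := by rwa [norm_algebraMap']
  have hq0 := q.ne_zero
  have hb0 := b.ne_zero
  have h1 : EvalsTo (1 - algebraMap K (Holo K) (b : K)⁻¹ * (coord : (Holo K)ˣ).val) α
      (aeval α (1 - C (b : K)⁻¹ * X)) := by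
    have h := evalsTo_ofPoly hα0 (1 - C (b : K)⁻¹ * X)
    have e : ofPoly (1 - C (b : K)⁻¹ * X) =
        1 - algebraMap K (Holo K) (b : K)⁻¹ * (coord : (Holo K)ˣ).val := by
      rw [ofPoly, map_sub, map_one, map_mul, aeval_C, aeval_X]
    rwa [e] at h
  refine ⟨_, ?_, h1.mul hα0 ((evalsTo_eulerHolo hq _ α).mul hα0 (evalsTo_eulerInvHolo hq _ α))⟩
  refine mul_ne_zero (fun h => hα ⟨b, ?_⟩) (mul_ne_zero
    (euler_ne_zero hqL fun k hk => hα ⟨(b : K) * ((q : K) ^ (k + 1))⁻¹, ?_⟩)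
    (euler_ne_zero hqL fun k hk => hα ⟨(b : K) * (q : K) ^ (k + 1), ?_⟩))
  all_goals
    have hqL0 : algebraMap K L q ≠ 0 := by rwa [_root_.map_ne_zero]
    have hbL0 : algebraMap K L b ≠ 0 := by rwa [_root_.map_ne_zero]
  · simp only [map_sub, map_one, map_mul, aeval_C, aeval_X, map_inv₀] at h
    field_simp at h
    linear_combination h
  · simp only [map_mul, map_inv₀, map_pow] at hk ⊢
    field_simp at hk ⊢
    linear_combination -hk
  · simp only [map_mul, map_pow] at hk ⊢
    field_simp at hk
    linear_combination hk

end Extension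

theorem not_ofPoly_dvd_theta (p : ℕ) [Fact p.Prime] [NormedAlgebra ℚ_[p] K] {q : Kˣ}
    (hq : ‖(q : K)‖ < 1) (b : Kˣ) {P : K[X]} (hP : Irreducible P) (hroot : ∀ a : K, ¬ P.IsRoot a) :
    ¬ ofPoly P ∣ theta hq b := by
  intro hdvd
  -- The spectral norm needs a nontrivial norm on K; q⁻¹ has norm greater than 1.
  let : NontriviallyNormedField K :=
    { ‹NormedField K› with
      non_trivial := ⟨((q⁻¹ : Kˣ) : K), by
        rw [Units.val_inv_eq_inv_val, norm_inv]
        exact (one_lt_inv₀ (norm_pos_iff.2 q.ne_zero)).2 hq⟩ }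
  have : Fact (Irreducible P) := ⟨hP⟩
  have : FiniteDimensional K (AdjoinRoot P) := (AdjoinRoot.powerBasis hP.ne_zero).finite
  let : NormedField (AdjoinRoot P) := spectralNorm.normedField K (AdjoinRoot P)
  let : NormedAlgebra K (AdjoinRoot P) := spectralNorm.normedAlgebra K (AdjoinRoot P)
  have : CompleteSpace (AdjoinRoot P) := spectralNorm.completeSpace K (AdjoinRoot P)
  have : IsUltrametricDist (AdjoinRoot P) :=
    IsUltrametricDist.isUltrametricDist_of_isNonarchimedean_norm isNonarchimedean_spectralNorm
  have h0 : aeval (AdjoinRoot.root P) P = 0 := by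
    rw [AdjoinRoot.aeval_eq, AdjoinRoot.mk_self]
  have hα : AdjoinRoot.root P ∉ Set.range (algebraMap K (AdjoinRoot P)) := by
    rintro ⟨a, ha⟩
    rw [← ha, aeval_algebraMap_apply, map_eq_zero_iff _ (algebraMap K (AdjoinRoot P)).injective] at h0
    exact hroot a h0
  obtain ⟨x, hx, hev⟩ := exists_evalsTo_theta_ne_zero hq b hα
  refine hx (hev.eq_zero_of_ofPoly_dvd p (fun h => hα ⟨0, ?_⟩) h0 hdvd)
  rw [h, map_zero]

/-- If k θ_b = 0, then k vanishes at every b λ^(i+1) with λ = 1 + p. These points avoid b q^ℤ,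
because |λ| = 1 and λ^(i+1) ≠ 1. Uniqueness applied to k(bu) gives k = 0. -/
theorem theta_mem_nonZeroDivisors (p : ℕ) [Fact p.Prime] [NormedAlgebra ℚ_[p] K] {q : Kˣ}
    (hq : ‖(q : K)‖ < 1) (b : Kˣ) : theta hq b ∈ nonZeroDivisors (Holo K) := by
  refine mem_nonZeroDivisors_iff_right.2 fun k hk => ?_
  have h0 : shiftEquiv b k = 0 := by
    refine Holo.eq_zero_of_eval_oneAddPrime (p := p) fun i => ?_
    change k.1 (b * oneAddPrime p K ^ (i + 1)) = 0
    have h1 : k.1 (b * oneAddPrime p K ^ (i + 1)) *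
        (theta hq b).1 (b * oneAddPrime p K ^ (i + 1)) = 0 := congrFun (congrArg Subtype.val hk) _
    refine (mul_eq_zero.1 h1).resolve_right (theta_ne_zero hq fun h => ?_)
    have h2 := QuotientGroup.eq.1 h.symm
    rw [inv_mul_cancel_left] at h2
    obtain ⟨m, hm⟩ := Subgroup.mem_zpowers_iff.1 h2
    have hnorm : ‖(q : K)‖ ^ m = 1 := by
      rw [← norm_zpow, ← Units.val_zpow_eq_zpow_val, hm, Units.val_pow_eq_pow_val, norm_pow,
        norm_oneAddPrime, one_pow]
    rw [(zpow_eq_one_iff_right₀ (norm_nonneg _) hq.ne).1 hnorm, zpow_zero] at hm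
    exact oneAddPrime_pow_succ_ne_one p K i hm.symm
  exact (map_eq_zero_iff _ (shiftEquiv b).injective).1 h0

/-- If |u - 1| < 1, then |u^n - 1| ≤ |u - 1| for all n in ℤ, so |f(u) - f(1)| ≤ M |u - 1| with M a
bound for the coefficients. -/
theorem Holo.continuousAt_one (f : Holo K) : ContinuousAt f.1 1 := by
  obtain ⟨a, ha⟩ := f.2
  obtain ⟨M, hM⟩ := (ha 1).summable.tendsto_cofinite_zero.norm.bddAbove_range_of_cofinite
  have hM' : ∀ n, ‖a n‖ ≤ M := fun n => hM ⟨n, by simp⟩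
  have hM0 : 0 ≤ M := (norm_nonneg _).trans (hM' 0)
  have hval : Tendsto (fun u : Kˣ => ‖(u : K) - 1‖) (𝓝 1) (𝓝 0) := by
    have h : Continuous fun u : Kˣ => ‖(u : K) - 1‖ := (Units.continuous_val.sub continuous_const).norm
    simpa using h.tendsto 1
  rw [ContinuousAt, tendsto_iff_norm_sub_tendsto_zero]
  refine squeeze_zero' (g := fun u : Kˣ => M * ‖(u : K) - 1‖)
    (Eventually.of_forall fun _ => norm_nonneg _) ?_ (by simpa using hval.const_mul M)
  filter_upwards [hval.eventually_lt_const one_pos] with u hu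
  have hu1 : ‖(u : K)‖ = 1 := by
    have h : ‖(u : K) - 1‖ ≠ ‖(1 : K)‖ := by rw [norm_one]; exact hu.ne
    have h' := IsUltrametricDist.norm_add_eq_max_of_norm_ne_norm h
    rwa [sub_add_cancel, norm_one, max_eq_right hu.le] at h'
  have hpow : ∀ n : ℕ, ‖(u : K) ^ n - 1‖ ≤ ‖(u : K) - 1‖ := by
    intro n
    induction n with
    | zero => simp
    | succ n ih =>
      have e : (u : K) ^ (n + 1) - 1 = u * ((u : K) ^ n - 1) + (u - 1) := by ring
      rw [e]
      refine (IsUltrametricDist.norm_add_le_max _ _).trans (max_le ?_ le_rfl)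
      rwa [norm_mul, hu1, one_mul]
  have hzpow : ∀ n : ℤ, ‖(u : K) ^ n - 1‖ ≤ ‖(u : K) - 1‖ := by
    intro n
    obtain ⟨k, rfl | rfl⟩ := n.eq_nat_or_neg
    · simpa using hpow k
    · have e : (u : K) ^ (-(k : ℤ)) - 1 = -((u : K) ^ k)⁻¹ * ((u : K) ^ k - 1) := by
        have := pow_ne_zero k u.ne_zero
        rw [zpow_neg, zpow_natCast]
        field_simp
        ring
      rw [e, norm_mul, norm_neg, norm_inv, norm_pow, hu1, one_pow, inv_one, one_mul]
      exact hpow k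
  rw [← ((ha u).sub (ha 1)).tsum_eq]
  refine IsUltrametricDist.norm_tsum_le_of_forall_le_of_nonneg (by positivity) fun n => ?_
  rw [Units.val_one, one_zpow, ← mul_sub, norm_mul]
  exact mul_le_mul (hM' n) (hzpow n) (norm_nonneg _) hM0

end Theta

/-! ### Normalized quotients of theta functions -/

section ThetaQuotient

/-- The cancellation behind the theta property: t and t' stand for θ_b and θ_1, s for the shifted
quotient, x for the coordinate and i for its inverse. -/
theorem eq_mul_mul_of_mul_neg_mul_eq {R : Type*} [CommRing R] {b c i s t t' x : R} (hix : i * x = 1)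
    (h : s * (-b * i * t) = c * (-1 * i * t')) : c * t' = b * s * t := by
  linear_combination x * h + (s * b * t - c * t') * hix

variable {K : Type*} [NormedField K] [IsUltrametricDist K] [CompleteSpace K] {q : Kˣ}

theorem smul_eq_algebraMap_mul (c : K) (f : Mero K) :
    c • f = algebraMap (Holo K) (Mero K) (algebraMap K (Holo K) c) * f := by
  rw [← IsScalarTower.algebraMap_apply, Algebra.smul_def]

theorem shift_algebraMap (g : Holo K) : shift q (algebraMap (Holo K) (Mero K) g) =
    algebraMap (Holo K) (Mero K) (shiftHom q g) :=
  IsFractionRing.ringEquivOfRingEquiv_algebraMap (shiftEquiv q) g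

variable (hq : ‖(q : K)‖ < 1)

theorem isUnit_algebraMap_theta (p : ℕ) [Fact p.Prime] [NormedAlgebra ℚ_[p] K] (b : Kˣ) :
    IsUnit (algebraMap (Holo K) (Mero K) (theta hq b)) :=
  IsLocalization.map_units (Mero K)
    (⟨theta hq b, theta_mem_nonZeroDivisors p hq b⟩ : nonZeroDivisors (Holo K))

/-- The factor by which the quotient of the theta functions with zeros `q^ℤ` and `b q^ℤ` is
multiplied to make it asymptotic to `1 - u` at `u = 1`. -/
noncomputable def thetaQuotientConst (b : Kˣ) : K :=
  (theta hq b).1 1 / (thetaCofactor hq 1).1 1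

theorem thetaQuotientConst_ne_zero {b : Kˣ} (hb : (b : TateCurve q) ≠ 1) :
    thetaQuotientConst hq b ≠ 0 :=
  div_ne_zero (theta_ne_zero hq hb.symm) (thetaCofactor_self_ne_zero hq 1)

variable (p : ℕ) [Fact p.Prime] [NormedAlgebra ℚ_[p] K]

/-- The meromorphic function with divisor `(1) - (b)` on `Kˣ / q^ℤ` that is asymptotic to `1 - u`
at `u = 1`: a multiple of the quotient of two theta functions. -/
noncomputable def thetaQuotient (b : Kˣ) : Mero K :=
  IsLocalization.mk' (Mero K) (algebraMap K (Holo K) (thetaQuotientConst hq b) * theta hq 1)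
    ⟨theta hq b, theta_mem_nonZeroDivisors p hq b⟩

theorem thetaQuotient_mul (b : Kˣ) :
    thetaQuotient hq p b * algebraMap (Holo K) (Mero K) (theta hq b) =
      algebraMap (Holo K) (Mero K)
        (algebraMap K (Holo K) (thetaQuotientConst hq b) * theta hq 1) :=
  IsLocalization.mk'_spec (Mero K) _
    (⟨theta hq b, theta_mem_nonZeroDivisors p hq b⟩ : nonZeroDivisors (Holo K))

theorem isTheta_thetaQuotient (b : Kˣ) : IsTheta q (thetaQuotient hq p b) := by
  -- The automorphy factors -1/u of θ_1 and -b/u of θ_b differ by the constant b, so no power of u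
  -- survives.
  refine ⟨b, 0, ?_⟩
  have h := congrArg (shift q) (thetaQuotient_mul hq p b)
  rw [map_mul, shift_algebraMap, shift_algebraMap, map_mul, shiftHom_theta, shiftHom_theta] at h
  have hc : ∀ c : K, shiftHom q (algebraMap K (Holo K) c) = algebraMap K (Holo K) c :=
    fun _ => rfl
  rw [hc] at h
  have h2 := thetaQuotient_mul hq p b
  refine (isUnit_algebraMap_theta hq p b).mul_right_cancel ?_
  rw [zpow_zero, Units.val_one, map_one, one_mul, smul_eq_algebraMap_mul, h2]
  have hcoord : algebraMap (Holo K) (Mero K) (coord⁻¹ : (Holo K)ˣ).val *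
      algebraMap (Holo K) (Mero K) (coord : (Holo K)ˣ).val = 1 := by
    rw [← map_mul, Units.inv_mul, map_one]
  simp only [map_mul, map_neg, Units.val_one, map_one] at h ⊢
  exact eq_mul_mul_of_mul_neg_mul_eq hcoord h

theorem hasDivisor_thetaQuotient {b : Kˣ} (hb : (b : TateCurve q) ≠ 1) :
    HasDivisor q (thetaQuotient hq p b)
      (Finsupp.single (1 : TateCurve q) 1 - Finsupp.single (b : TateCurve q) 1) := by
  classical
  have hcu := isUnit_algebraMap_holo (K := K) (thetaQuotientConst_ne_zero hq hb)
  refine ⟨fun a => ?_, fun P hP hroot => ?_⟩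
  · obtain ⟨g, hg, hg'⟩ := exists_theta_eq_mul_pow hq 1 a
    obtain ⟨h, hh, hh'⟩ := exists_theta_eq_mul_pow hq b a
    refine ⟨algebraMap K (Holo K) (thetaQuotientConst hq b) * g, h,
      if (a : TateCurve q) = (1 : Kˣ) then 1 else 0, if (a : TateCurve q) = b then 1 else 0,
      not_ofPoly_dvd_of_apply_ne_zero
        (mul_ne_zero (isUnit_apply_ne_zero hcu a) hg),
      not_ofPoly_dvd_of_apply_ne_zero hh, ?_, ?_⟩
    · rw [Finsupp.sub_apply, Finsupp.single_apply, Finsupp.single_apply]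
      push_cast
      simp only [eq_comm, QuotientGroup.mk_one]
    · rw [mul_assoc, ← hg', ← hh', thetaQuotient_mul]
  · refine ⟨algebraMap K (Holo K) (thetaQuotientConst hq b) * theta hq 1, theta hq b, 0, 0,
      fun hdvd => ?_, not_ofPoly_dvd_theta p hq b hP hroot, by simp, ?_⟩
    · exact not_ofPoly_dvd_theta p hq 1 hP hroot (hcu.dvd_mul_left.1 hdvd)
    · rw [pow_zero, mul_one, mul_one, thetaQuotient_mul]

/-- The factor 1 - u of θ_1 cancels; the rest is continuous at 1, with value 1 by the choice of the
constant. -/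
theorem tendsto_eval_thetaQuotient {b : Kˣ} (hb : (b : TateCurve q) ≠ 1) :
    Tendsto (fun u : Kˣ => eval (thetaQuotient hq p b) u / (1 - (u : K))) (𝓝[≠] 1) (𝓝 1) := by
  have hb1 : (theta hq b).1 1 ≠ 0 := theta_ne_zero hq hb.symm
  have hc1 : (thetaCofactor hq 1).1 1 ≠ 0 := thetaCofactor_self_ne_zero hq 1
  have hlim : Tendsto (fun u : Kˣ => thetaQuotientConst hq b * (thetaCofactor hq 1).1 u /
      (theta hq b).1 u) (𝓝[≠] 1) (𝓝 1) := by
    have h := (((Holo.continuousAt_one (thetaCofactor hq 1)).tendsto.const_mul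
      (thetaQuotientConst hq b)).div (Holo.continuousAt_one (theta hq b)).tendsto hb1).mono_left
        (nhdsWithin_le_nhds (s := {1}ᶜ))
    have e : thetaQuotientConst hq b * (thetaCofactor hq 1).1 1 / (theta hq b).1 1 = 1 := by
      rw [thetaQuotientConst]
      field_simp
    rwa [e] at h
  refine hlim.congr' ?_
  have hne : ∀ᶠ u in 𝓝[≠] (1 : Kˣ), (theta hq b).1 u ≠ 0 :=
    ((Holo.continuousAt_one (theta hq b)).eventually_ne hb1).filter_mono nhdsWithin_le_nhds
  filter_upwards [hne, self_mem_nhdsWithin] with u hu hu1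
  have hval : HasValue (thetaQuotient hq p b) u
      ((algebraMap K (Holo K) (thetaQuotientConst hq b) * theta hq 1).1 u / (theta hq b).1 u) :=
    ⟨_, _, hu, thetaQuotient_mul hq p b, rfl⟩
  have h1u : 1 - (u : K) ≠ 0 := fun h => hu1 (Units.ext (sub_eq_zero.1 h).symm)
  rw [hval.eval_eq]
  change _ = thetaQuotientConst hq b * (theta hq 1).1 u / _ / _
  rw [theta_apply hq 1, Units.val_one, inv_one, one_mul]
  field_simp

end ThetaQuotient

end TateTheta

theorem mainTheorem12 {p : ℕ} [Fact p.Prime] {K : Type*} [NormedField K] [NormedAlgebra ℚ_[p] K]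
    [IsUltrametricDist K] [CompleteSpace K] (q : Kˣ) (hq : ‖(q : K)‖ < 1)
    (l : ℕ) (hl : l.Prime) (hl3 : 3 ≤ l) :
    ∃ f : Kˣ → TateTheta.Mero K, ∀ Q : Kˣ,
      (Q : TateTheta.TateCurve q) ^ l = 1 → (Q : TateTheta.TateCurve q) ≠ 1 →
        TateTheta.IsTheta q (f Q) ∧
        TateTheta.HasDivisor q (f Q)
          (Finsupp.single (1 : TateTheta.TateCurve q) 1 -
            Finsupp.single (Q : TateTheta.TateCurve q) 1) ∧
        Tendsto (fun u : Kˣ => TateTheta.eval (f Q) u / (1 - (u : K))) (𝓝[≠] 1) (𝓝 1) ∧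
        ∀ m : ℤ, ∃ μ : K, μ ^ l = 1 ∧ f (Q * q ^ m) = μ • f Q := by
  refine ⟨fun Q => TateTheta.thetaQuotient hq p (Q : TateTheta.TateCurve q).out,
    fun Q _ hQ => ?_⟩
  -- The divisor and the condition at `1` determine `f Q` up to a power of `u`; fixing one
  -- representative of each class makes the choices for `Q` and `Q * q ^ m` agree.
  have hout : (((Q : TateTheta.TateCurve q).out : Kˣ) : TateTheta.TateCurve q) = Q :=
    QuotientGroup.out_eq' _
  have hne : (((Q : TateTheta.TateCurve q).out : Kˣ) : TateTheta.TateCurve q) ≠ 1 := by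
    rwa [hout]
  refine ⟨TateTheta.isTheta_thetaQuotient hq p _, ?_,
    TateTheta.tendsto_eval_thetaQuotient hq p hne, fun m => ⟨1, one_pow l, ?_⟩⟩
  · have h := TateTheta.hasDivisor_thetaQuotient hq p hne
    rwa [hout] at h
  · rw [one_smul]
    simp only [TateTheta.mk_eq_mk_of_eq_mul_zpow (rfl : Q * q ^ m = Q * q ^ m)]
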